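/- For complex $a,q$ with $|q|<1$ put $(a;q)_n=\prod_{k=0}^{n-1}(1-aq^k)$ for $n=0,1,2,\dots$, $(a;q)_\infty=\prod_{k=0}^{\infty}(1-aq^k)$, and $(a_1,\dots,a_m;q)_n=(a_1;q)_n\cdots(a_m;q)_n$ (also for $n=\infty$). Let $q\in\mathbb{C}$ with $|q|<1$. (i) For all nonzero $a,b\in\mathbb{C}$ with $\max\{|aq^3|,|bq^3|,|abq^2|\}<1$, both series below converge absolutely and $$\frac{(q^3,abq^2;q)_\infty}{(aq^3,bq^3;q)_\infty}\sum_{n=0}^{\infty}\frac{(q/a,q/b;q)_n\,(q^3;q^3)_n}{(q;q)_n\,(q^3;q)_{2n}}\,a^nb^nq^{2n} =\sum_{n=0}^{\infty}(-1)^n(1-q^{6n+3})\frac{(q/a,q/b;q)_{3n}}{(aq^3,bq^3;q)_{3n}}\,a^{3n}b^{3n}q^{\frac{9n^2+15n}{2}}.$$ (ii) The following identities from Slater's list hold, the series converging absolutely: $$\sum_{n=0}^{\infty}\frac{(-q;q)_{n+1}(q^3;q^3)_n}{(q;q)_n(q;q)_{2n+2}}q^{\frac{n^2+3n}{2}}=\frac{(-q;q)_\infty(q^3,q^{15},q^{18};q^{18})_\infty}{(q;q)_\infty},\tag{S.76}$$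 $$\sum_{n=0}^{\infty}\frac{(q^3;q^3)_n}{(q;q)_n(q;q)_{2n+2}}q^{n^2+3n}=\frac{(q^3,q^{24},q^{27};q^{27})_\infty}{(q;q)_\infty},\tag{S.90}$$ $$\sum_{n=0}^{\infty}\frac{(-q;q^2)_{n+1}(q^6;q^6)_n}{(q^2;q^2)_{2n+2}(q^2;q^2)_n}q^{n^2+4n}=\frac{(-q;q^2)_\infty(q^3,q^{33},q^{36};q^{36})_\infty}{(q^2;q^2)_\infty}.\tag{S.116}$$ -/

import Mathlib

/-- The finite `q`-shifted factorial `(a;q)_n = ∏_{k=0}^{n-1} (1 - a q^k)`, with `(a;q)_0 = 1`. -/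
noncomputable def qPoch (a q : ℂ) (n : ℕ) : ℂ :=
  ∏ k ∈ Finset.range n, (1 - a * q ^ k)

/-- The infinite `q`-shifted factorial `(a;q)_∞ = ∏_{k=0}^∞ (1 - a q^k)`. -/
noncomputable def qPochInf (a q : ℂ) : ℂ :=
  ∏' k : ℕ, (1 - a * q ^ k)

/-- For `|q| < 1` the product defining `(a;q)_∞` converges, so `qPochInf` is a genuine product. -/
theorem hasProd_qPochInf (a : ℂ) {q : ℂ} (hq : ‖q‖ < 1) :
    HasProd (fun k : ℕ => 1 - a * q ^ k) (qPochInf a q) := by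
  have h : Summable (fun k : ℕ => ‖-(a * q ^ k)‖) := by
    simp only [norm_neg, norm_mul, norm_pow]
    exact (summable_geometric_of_lt_one (norm_nonneg q) hq).mul_left _
  have hm := multipliable_one_add_of_summable h
  simp only [← sub_eq_add_neg] at hm
  exact hm.hasProd

/-! The transformation is Bailey's lemma applied to a cubic Bailey pair relative to `q ^ 3`. The
absolutely convergent double series `baileyTerm` is summed in two ways. On antidiagonals the
defining relation of the pair (`sum_baileyAlpha`) produces the series with (q^3;q^3)_n. On rows the
q-Gauss sum (`hasSum_gaussTerm`) applies, and since the α-sequence lives on multiples of 3, only the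
indices 3r remain.

The pair comes from a finite Jacobi triple product with x = ζq^2, y = ζ^2/q, summed over the cube
roots of unity ζ: this kills the indices not divisible by 3, while the products combine into
(q^3;q^3)_n/(q;q)_n. The q-Gauss sum follows by iterating a contiguous relation t → tq.

Replacing a^n (q/a;q)_n by the polynomial `homPoch` admits a = 0 without a limit. Slater's
identities are a = b = 0 (S.90), a = 0, b = -1/q (S.76), and the latter parameters with base q^2
(S.116); in each case the row side collapses to a Jacobi triple product. -/

open Filter Topology

/-! ### Finite and infinite q-shifted factorials: recursions, nonvanishing, bounds -/

theorem qPoch_zero (a q : ℂ) : qPoch a q 0 = 1 := by simp [qPoch]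

theorem qPoch_succ (a q : ℂ) (n : ℕ) :
    qPoch a q (n + 1) = qPoch a q n * (1 - a * q ^ n) := by
  simp [qPoch, Finset.prod_range_succ]

theorem qPoch_add (a q : ℂ) (m n : ℕ) :
    qPoch a q (m + n) = qPoch a q m * qPoch (a * q ^ m) q n := by
  simp only [qPoch, Finset.prod_range_add, pow_add, mul_assoc]

theorem qPoch_succ' (a q : ℂ) (n : ℕ) :
    qPoch a q (n + 1) = (1 - a) * qPoch (a * q) q n := by
  rw [add_comm, qPoch_add]; simp [qPoch]

theorem norm_mul_pow_lt_one {a q : ℂ} (hq : ‖q‖ < 1) (ha : ‖a‖ < 1) (n : ℕ) :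
    ‖a * q ^ n‖ < 1 := by
  rw [norm_mul, norm_pow]
  calc ‖a‖ * ‖q‖ ^ n ≤ ‖a‖ * 1 := by
        gcongr
        exact pow_le_one₀ (norm_nonneg q) hq.le
    _ < 1 := by simpa using ha

theorem one_sub_ne_zero_of_norm_lt_one {a : ℂ} (ha : ‖a‖ < 1) : 1 - a ≠ 0 := by
  intro h
  rw [← sub_eq_zero.mp h] at ha
  simp at ha

theorem qPoch_ne_zero {a q : ℂ} (hq : ‖q‖ < 1) (ha : ‖a‖ < 1) (n : ℕ) : qPoch a q n ≠ 0 :=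
  Finset.prod_ne_zero_iff.mpr fun k _ =>
    one_sub_ne_zero_of_norm_lt_one (norm_mul_pow_lt_one hq ha k)

theorem tendsto_qPoch (a : ℂ) {q : ℂ} (hq : ‖q‖ < 1) :
    Tendsto (qPoch a q) atTop (𝓝 (qPochInf a q)) :=
  (hasProd_qPochInf a hq).tendsto_prod_nat

theorem qPochInf_ne_zero {a q : ℂ} (hq : ‖q‖ < 1) (ha : ‖a‖ < 1) : qPochInf a q ≠ 0 := by
  have h : Summable (fun k : ℕ => ‖-(a * q ^ k)‖) := by
    simp only [norm_neg, norm_mul, norm_pow]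
    exact (summable_geometric_of_lt_one (norm_nonneg q) hq).mul_left _
  have := tprod_one_add_ne_zero_of_summable (f := fun k : ℕ => -(a * q ^ k))
    (fun k => by
      rw [← sub_eq_add_neg]
      exact one_sub_ne_zero_of_norm_lt_one (norm_mul_pow_lt_one hq ha k)) h
  simpa only [qPochInf, ← sub_eq_add_neg] using this

theorem qPochInf_eq_qPoch_mul (a : ℂ) {q : ℂ} (hq : ‖q‖ < 1) (n : ℕ) :
    qPochInf a q = qPoch a q n * qPochInf (a * q ^ n) q := by
  refine tendsto_nhds_unique ((tendsto_qPoch a hq).comp (tendsto_add_atTop_nat n)) ?_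
  refine ((tendsto_qPoch (a * q ^ n) hq).const_mul (qPoch a q n)).congr fun m => ?_
  simp [add_comm m n, qPoch_add]

theorem exists_norm_le_of_tendsto {f : ℕ → ℂ} {l : ℂ} (h : Tendsto f atTop (𝓝 l)) :
    ∃ K : ℝ, 0 < K ∧ ∀ n, ‖f n‖ ≤ K := by
  obtain ⟨K, hK⟩ := (Metric.isBounded_range_of_tendsto f h).exists_norm_le
  exact ⟨max K 1, by positivity, fun n => (hK _ ⟨n, rfl⟩).trans (le_max_left _ _)⟩

theorem exists_norm_qPoch_le (a : ℂ) {q : ℂ} (hq : ‖q‖ < 1) :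
    ∃ K : ℝ, 0 < K ∧ ∀ n, ‖qPoch a q n‖ ≤ K :=
  exists_norm_le_of_tendsto (tendsto_qPoch a hq)

theorem exists_norm_inv_qPoch_le {a q : ℂ} (hq : ‖q‖ < 1) (ha : ‖a‖ < 1) :
    ∃ K : ℝ, 0 < K ∧ ∀ n, ‖(qPoch a q n)⁻¹‖ ≤ K :=
  exists_norm_le_of_tendsto ((tendsto_qPoch a hq).inv₀ (qPochInf_ne_zero hq ha))

/-! ### Homogeneous q-shifted factorials -/

/-- `∏_{k<n} (a - q^{k+1})`, which is `a^n (q/a;q)_n` for nonzero `a`. -/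
noncomputable def homPoch (a q : ℂ) (n : ℕ) : ℂ := ∏ k ∈ Finset.range n, (a - q ^ (k + 1))

theorem homPoch_eq {a : ℂ} (ha : a ≠ 0) (q : ℂ) (n : ℕ) :
    homPoch a q n = a ^ n * qPoch (q / a) q n := by
  rw [homPoch, qPoch, show a ^ n = ∏ k ∈ Finset.range n, a by simp, ← Finset.prod_mul_distrib]
  refine Finset.prod_congr rfl fun k _ => ?_
  field_simp
  ring

/-- Source of the quadratic exponents in Slater's identities. -/
theorem homPoch_zero_left (q : ℂ) (n : ℕ) :
    homPoch 0 q n = (-1) ^ n * q ^ ((n + 1).choose 2) := by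
  induction n with
  | zero => simp [homPoch]
  | succ n ih =>
    rw [homPoch, Finset.prod_range_succ, ← homPoch, ih, Nat.choose_succ_succ' (n + 1) 1,
      Nat.choose_one_right]
    ring

/-- `homPoch a q n` grows at most like `ρ^n` for every `ρ > ‖a‖`. -/
theorem exists_norm_homPoch_le {a q : ℂ} (hq : ‖q‖ < 1) {ρ : ℝ} (hρ : 0 < ρ) (ha : ‖a‖ ≤ ρ) :
    ∃ K : ℝ, 0 < K ∧ ∀ n, ‖homPoch a q n‖ ≤ K * ρ ^ n := by
  -- Each factor is at most ρ(1 + ‖q‖^(k+1)/ρ), so the majorant is ρ^n times a shifted factorial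
  -- with base ‖q‖ and parameter -‖q‖/ρ.
  obtain ⟨K, hK0, hK⟩ := exists_norm_qPoch_le (-(‖q‖ / ρ : ℝ) : ℂ) (q := (‖q‖ : ℂ))
    (by simpa using hq)
  refine ⟨K, hK0, fun n => ?_⟩
  refine le_trans ?_ (mul_le_mul_of_nonneg_right (hK n) (by positivity))
  rw [homPoch, qPoch, norm_prod, norm_prod]
  rw [show ρ ^ n = ∏ k ∈ Finset.range n, ρ by simp, ← Finset.prod_mul_distrib]
  refine Finset.prod_le_prod (fun _ _ => norm_nonneg _) fun k _ => ?_
  have h1 : ‖(1 - (-(‖q‖ / ρ : ℝ) : ℂ) * (‖q‖ : ℂ) ^ k)‖ = 1 + ‖q‖ / ρ * ‖q‖ ^ k := by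
    have : (1 - (-(‖q‖ / ρ : ℝ) : ℂ) * (‖q‖ : ℂ) ^ k) = ((1 + ‖q‖ / ρ * ‖q‖ ^ k : ℝ) : ℂ) := by
      push_cast; ring
    rw [this, Complex.norm_real, Real.norm_of_nonneg (by positivity)]
  rw [h1]
  calc ‖a - q ^ (k + 1)‖ ≤ ‖a‖ + ‖q‖ ^ (k + 1) := by
        simpa using norm_sub_le a (q ^ (k + 1))
    _ ≤ ρ + ‖q‖ ^ (k + 1) := by gcongr
    _ = (1 + ‖q‖ / ρ * ‖q‖ ^ k) * ρ := by field_simp; ring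

/-! ### Gaussian binomials and the q-binomial theorem -/

/-- Gaussian binomial coefficients, by the `q`-Pascal recursion. -/
noncomputable def gaussBinom (q : ℂ) : ℕ → ℕ → ℂ
  | _, 0 => 1
  | 0, _ + 1 => 0
  | n + 1, k + 1 => q ^ (k + 1) * gaussBinom q n (k + 1) + gaussBinom q n k

theorem gaussBinom_zero_right (q : ℂ) (n : ℕ) : gaussBinom q n 0 = 1 := by
  cases n <;> rfl

theorem gaussBinom_succ_succ (q : ℂ) (n k : ℕ) :
    gaussBinom q (n + 1) (k + 1) = q ^ (k + 1) * gaussBinom q n (k + 1) + gaussBinom q n k := rfl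

theorem gaussBinom_eq_zero (q : ℂ) : ∀ {n k : ℕ}, n < k → gaussBinom q n k = 0
  | 0, _ + 1, _ => rfl
  | n + 1, k + 1, h => by
    rw [gaussBinom_succ_succ, gaussBinom_eq_zero q (by omega), gaussBinom_eq_zero q (by omega)]
    simp

/-- The finite `q`-binomial theorem. -/
theorem sum_gaussBinom (q z : ℂ) (n : ℕ) :
    ∑ j ∈ Finset.range (n + 1), (-1) ^ j * q ^ (j.choose 2) * z ^ j * gaussBinom q n j
      = qPoch z q n := by
  induction n generalizing z with
  | zero => simp [gaussBinom_zero_right, qPoch]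
  | succ n ih =>
    -- In the q-Pascal rule the factor q^(j+1) turns z into zq, and the other term is -z times the
    -- full sum at zq. Together they give (1 - z)(zq;q)_n.
    have key : ∑ j ∈ Finset.range (n + 1), (-1) ^ (j + 1) * q ^ ((j + 1).choose 2) * z ^ (j + 1) *
          gaussBinom q (n + 1) (j + 1)
        = ∑ j ∈ Finset.range n, (-1) ^ (j + 1) * q ^ ((j + 1).choose 2) * (z * q) ^ (j + 1) *
            gaussBinom q n (j + 1)
          - z * ∑ j ∈ Finset.range (n + 1), (-1) ^ j * q ^ (j.choose 2) * (z * q) ^ j *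
            gaussBinom q n j := by
      have h0 : ∑ j ∈ Finset.range n, (-1) ^ (j + 1) * q ^ ((j + 1).choose 2) * (z * q) ^ (j + 1) *
            gaussBinom q n (j + 1)
          = ∑ j ∈ Finset.range (n + 1), (-1) ^ (j + 1) * q ^ ((j + 1).choose 2) *
            (z * q) ^ (j + 1) * gaussBinom q n (j + 1) := by
        rw [Finset.sum_range_succ, gaussBinom_eq_zero q (Nat.lt_succ_self n)]
        simp
      rw [h0, Finset.mul_sum, ← Finset.sum_sub_distrib]
      refine Finset.sum_congr rfl fun j _ => ?_
      rw [gaussBinom_succ_succ, Nat.choose_succ_succ' j 1, Nat.choose_one_right]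
      ring
    have h1 := ih (z * q)
    have h2 := h1
    rw [Finset.sum_range_succ'] at h2
    rw [qPoch_succ', Finset.sum_range_succ', key]
    simp only [gaussBinom_zero_right] at h2 ⊢
    linear_combination h2 - z * h1

/-- The induction step is 1 - q^(k+m+2) = q^(k+1)(1 - q^(m+1)) + (1 - q^(k+1)), matched with
q-Pascal. -/
theorem gaussBinom_mul_qPoch (q : ℂ) (k m : ℕ) :
    gaussBinom q (k + m) k * (qPoch q q k * qPoch q q m) = qPoch q q (k + m) := by
  induction k generalizing m with
  | zero => simp [gaussBinom_zero_right, qPoch_zero]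
  | succ k ih =>
    induction m with
    | zero =>
      have h := ih 0
      simp only [Nat.add_zero, qPoch_zero, mul_one] at h ⊢
      rw [gaussBinom_succ_succ, gaussBinom_eq_zero q (Nat.lt_succ_self k), qPoch_succ]
      linear_combination (1 - q * q ^ k) * h
    | succ m ihm =>
      have h := ih (m + 1)
      rw [show k + 1 + (m + 1) = (k + 1 + m) + 1 by ring, gaussBinom_succ_succ,
        qPoch_succ q q (k + 1 + m)]
      rw [show k + (m + 1) = k + 1 + m by ring] at h
      rw [qPoch_succ q q m] at h ⊢
      rw [qPoch_succ q q k] at ihm ⊢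
      linear_combination q ^ (k + 1) * (1 - q * q ^ m) * ihm + (1 - q * q ^ k) * h

/-! ### The Jacobi triple product, finite and infinite -/

/-- This and `choose_two_shift_sub` are the exponent counts for the upper and lower halves of the
q-binomial sum when it is recentred at its middle. -/
theorem choose_two_shift_add (M k : ℕ) :
    (M + 1).choose 2 + (M + 1) + (M + 1 + k).choose 2 = (M + 1) * (M + 1 + k) + k.choose 2 := by
  induction k with
  | zero =>
    have := Nat.triangle_succ (M + 1)
    have h := Nat.choose_two_right (M + 1)
    have h2 := Nat.even_mul_pred_self (M + 1)
    obtain ⟨c, hc⟩ := h2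
    simp only [Nat.add_sub_cancel] at h hc
    simp
    have : (M + 1) * (M + 1) = (M + 1) * M + (M + 1) := by ring
    omega
  | succ k ih =>
    rw [← add_assoc (M + 1) k 1, Nat.choose_succ_succ' (M + 1 + k) 1, Nat.choose_succ_succ' k 1]
    simp only [Nat.choose_one_right]
    linarith

theorem choose_two_shift_sub (d k : ℕ) :
    (d + k + 1).choose 2 + d + d.choose 2 = (d + k + 1) * d + (k + 1).choose 2 := by
  induction d with
  | zero => simp
  | succ d ih =>
    rw [show d + 1 + k + 1 = d + k + 1 + 1 by ring, Nat.choose_succ_succ' (d + k + 1) 1,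
      Nat.choose_succ_succ' d 1]
    simp only [Nat.choose_one_right]
    linarith

/-- Since xy = q, each factor satisfies 1 - x q^(-j) = -x q^(-j) (1 - y q^(j-1)); this turns factors
with negative powers of q into factors in y. -/
theorem qPoch_mul_inv_pow {q x y : ℂ} (hq : q ≠ 0) (hxy : x * y = q) (n : ℕ) :
    (-1) ^ n * y ^ n * q ^ (n.choose 2) * qPoch (x * (q⁻¹) ^ n) q n = qPoch y q n := by
  have h : qPoch (x * (q⁻¹) ^ n) q n = ∏ k ∈ Finset.range n, (1 - x * (q⁻¹) ^ (k + 1)) := by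
    rw [← Finset.prod_range_reflect, qPoch]
    refine Finset.prod_congr rfl fun k hk => ?_
    have hk := Finset.mem_range.mp hk
    obtain ⟨d, rfl⟩ := Nat.exists_eq_add_of_lt hk
    rw [show k + d + 1 - 1 - k + 1 = d + 1 by omega, show k + d + 1 = d + 1 + k by ring,
      pow_add q⁻¹ (d + 1) k]
    have : (q⁻¹) ^ k * q ^ k = 1 := by rw [← mul_pow, inv_mul_cancel₀ hq, one_pow]
    linear_combination (-x * (q⁻¹) ^ (d + 1)) * this
  rw [h]
  clear h
  induction n with
  | zero => simp [qPoch]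
  | succ n ih =>
    rw [Finset.prod_range_succ, qPoch_succ, ← ih, Nat.choose_succ_succ' n 1, Nat.choose_one_right]
    have : x * q⁻¹ ^ (n + 1) * (y * q ^ n) = 1 := by
      rw [pow_succ, inv_pow]; field_simp; exact hxy
    linear_combination (-1) ^ n * y ^ n * q ^ (n.choose 2) *
      (∏ k ∈ Finset.range n, (1 - x * (q⁻¹) ^ (k + 1))) * this

/-- A finite form of the Jacobi triple product, with the terms `k` and `-k-1` combined. -/
theorem finite_triple_product {q x y : ℂ} (hq : q ≠ 0) (hxy : x * y = q) (M : ℕ) :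
    ∑ k ∈ Finset.range (M + 1), (-1) ^ k * gaussBinom q (2 * M + 1) (M + 1 + k)
        * (x ^ k * q ^ (k.choose 2))
      - ∑ k ∈ Finset.range (M + 1), (-1) ^ k * gaussBinom q (2 * M + 1) (M - k)
        * (y ^ (k + 1) * q ^ ((k + 1).choose 2))
      = qPoch y q (M + 1) * qPoch x q M := by
  -- At z = x q^(-(M+1)) the first M + 1 factors of (z;q)_{2M+1} become (y;q)_{M+1} and the last M
  -- are (x;q)_M. The sum is cut at j = M + 1 and its lower half reversed.
  have hb := sum_gaussBinom q (x * (q⁻¹) ^ (M + 1)) (2 * M + 1)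
  rw [show 2 * M + 1 + 1 = (M + 1) + (M + 1) by ring, Finset.sum_range_add,
    ← Finset.sum_range_reflect _ (M + 1),
    show 2 * M + 1 = (M + 1) + M by ring, qPoch_add] at hb
  have hx : x * q⁻¹ ^ (M + 1) * q ^ (M + 1) = x := by
    rw [mul_assoc, ← mul_pow, inv_mul_cancel₀ hq]; simp
  rw [hx] at hb
  rw [← qPoch_mul_inv_pow hq hxy (M + 1), mul_assoc, ← hb, mul_add, Finset.mul_sum,
    Finset.mul_sum, show 2 * M + 1 = (M + 1) + M by ring, add_comm (Finset.sum _ _) (Finset.sum _ _), sub_eq_add_neg,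
    ← Finset.sum_neg_distrib]
  congr 1
  · refine Finset.sum_congr rfl fun k _ => ?_
    have e : q ^ ((M + 1).choose 2) * q ^ (M + 1) * q ^ ((M + 1 + k).choose 2)
        * ((q⁻¹) ^ (M + 1)) ^ (M + 1 + k) = q ^ (k.choose 2) := by
      rw [← pow_add, ← pow_add, choose_two_shift_add, ← pow_mul, pow_add, inv_pow]
      field_simp
    have s : ((-1 : ℂ)) ^ (M + 1) * (-1) ^ (M + 1 + k) = (-1) ^ k := by
      rw [pow_add _ (M + 1) k, ← mul_assoc, ← mul_pow]; simp
    rw [← e, ← s]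
    have hxy' : q ^ (M + 1) = x ^ (M + 1) * y ^ (M + 1) := by rw [← mul_pow, hxy]
    rw [hxy', mul_pow, pow_add x (M + 1) k]
    ring
  · refine Finset.sum_congr rfl fun k hk => ?_
    obtain ⟨d, rfl⟩ := Nat.exists_eq_add_of_le (Nat.lt_succ_iff.mp (Finset.mem_range.mp hk))
    rw [show k + d + 1 - 1 - k = d by omega, show k + d - k = d by omega,
      show k + d + 1 = d + k + 1 by ring]
    have e : q ^ ((d + k + 1).choose 2) * q ^ d * q ^ (d.choose 2)
        * ((q⁻¹) ^ (d + k + 1)) ^ d = q ^ ((k + 1).choose 2) := by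
      rw [← pow_add, ← pow_add, choose_two_shift_sub, ← pow_mul, pow_add, inv_pow]
      field_simp
    have s : ((-1 : ℂ)) ^ (d + k + 1) * (-1) ^ d = - (-1) ^ k := by
      have : ((-1 : ℂ)) ^ d * (-1) ^ d = 1 := by rw [← mul_pow]; simp
      linear_combination -(-1 : ℂ) ^ k * this
    have hxy' : q ^ d = x ^ d * y ^ d := by rw [← mul_pow, hxy]
    rw [← e, hxy', mul_pow]
    linear_combination (-y ^ (d + k + 1) * x ^ d * q ^ ((d + k + 1).choose 2) * q ^ (d.choose 2)
        * ((q⁻¹) ^ (d + k + 1)) ^ d * gaussBinom q (d + k + 1 + (k + d)) d) * s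

theorem gaussBinom_eq_div {q : ℂ} (hq : ‖q‖ < 1) (k m : ℕ) :
    gaussBinom q (k + m) k = qPoch q q (k + m) * ((qPoch q q k)⁻¹ * (qPoch q q m)⁻¹) := by
  rw [← gaussBinom_mul_qPoch]
  have h1 := qPoch_ne_zero hq hq k
  have h2 := qPoch_ne_zero hq hq m
  field_simp

/-- Symmetry of the Gaussian binomial gives the terms k and -k-1 the same weight, here written in
factors that converge as M → ∞. -/
theorem finite_triple_product_div {q x y : ℂ} (hq : q ≠ 0) (hq1 : ‖q‖ < 1) (hxy : x * y = q)
    (M : ℕ) :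
    ∑ k ∈ Finset.range (M + 1),
        (-1) ^ k * (x ^ k * q ^ (k.choose 2) - y ^ (k + 1) * q ^ ((k + 1).choose 2))
          * (qPoch q q (2 * M + 1) * ((qPoch q q (M + 1 + k))⁻¹ * (qPoch q q (M - k))⁻¹))
      = qPoch y q (M + 1) * qPoch x q M := by
  rw [← finite_triple_product hq hxy M, ← Finset.sum_sub_distrib]
  refine Finset.sum_congr rfl fun k hk => ?_
  obtain ⟨d, rfl⟩ := Nat.exists_eq_add_of_le (Nat.lt_succ_iff.mp (Finset.mem_range.mp hk))
  have h1 := gaussBinom_eq_div hq1 (k + d + 1 + k) d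
  have h2 := gaussBinom_eq_div hq1 d (k + d + 1 + k)
  rw [show k + d + 1 + k + d = 2 * (k + d) + 1 by ring] at h1
  rw [show d + (k + d + 1 + k) = 2 * (k + d) + 1 by ring] at h2
  rw [show k + d - k = d by omega, h1, h2]
  ring

/-- The Jacobi triple product, with the terms `k` and `-k-1` combined. -/
theorem hasSum_triple_product {q x y : ℂ} (hq : q ≠ 0) (hq1 : ‖q‖ < 1) (hxy : x * y = q)
    (hx : ‖x‖ < 1) (hy : ‖y‖ < 1) :
    HasSum (fun k : ℕ =>
      (-1) ^ k * (x ^ k * q ^ (k.choose 2) - y ^ (k + 1) * q ^ ((k + 1).choose 2)))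
      (qPochInf x q * qPochInf y q * qPochInf q q) := by
  set c : ℕ → ℂ := fun k =>
    (-1) ^ k * (x ^ k * q ^ (k.choose 2) - y ^ (k + 1) * q ^ ((k + 1).choose 2)) with hc
  have hcb : ∀ k, ‖c k‖ ≤ ‖x‖ ^ k + ‖y‖ ^ k := fun k => by
    have hqp : ∀ m, ‖q‖ ^ m ≤ 1 := fun m => pow_le_one₀ (norm_nonneg q) hq1.le
    rw [hc]
    simp only [norm_mul, norm_pow, norm_neg, norm_one, one_pow, one_mul]
    refine (norm_sub_le _ _).trans ?_
    simp only [norm_mul, norm_pow]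
    refine add_le_add (mul_le_of_le_one_right (by positivity) (hqp _)) ?_
    refine (mul_le_of_le_one_right (by positivity) (hqp _)).trans ?_
    exact pow_le_pow_of_le_one (norm_nonneg y) hy.le (Nat.le_succ k)
  have hbs : Summable fun k : ℕ => ‖x‖ ^ k + ‖y‖ ^ k :=
    (summable_geometric_of_lt_one (norm_nonneg x) hx).add
      (summable_geometric_of_lt_one (norm_nonneg y) hy)
  have hcs : Summable c := Summable.of_norm_bounded hbs hcb
  set L := qPochInf q q with hL
  have hL0 : L ≠ 0 := qPochInf_ne_zero hq1 hq1
  obtain ⟨K, hK0, hK⟩ := exists_norm_qPoch_le q hq1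
  obtain ⟨K', hK0', hK'⟩ := exists_norm_inv_qPoch_le hq1 hq1
  -- Extension by zero makes dominated convergence applicable and discards the range where `M - k`
  -- truncates. For fixed k the weight tends to 1/(q;q)_∞.
  let F : ℕ → ℕ → ℂ := fun M k => if k < M + 1 then
    c k * (qPoch q q (2 * M + 1) * ((qPoch q q (M + 1 + k))⁻¹ * (qPoch q q (M - k))⁻¹)) else 0
  have hF : ∀ M, ∑' k, F M k = qPoch y q (M + 1) * qPoch x q M := fun M => by
    rw [← finite_triple_product_div hq hq1 hxy M,
      tsum_eq_sum (s := Finset.range (M + 1)) fun k hk => if_neg (by simpa using hk)]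
    exact Finset.sum_congr rfl fun k hk => if_pos (Finset.mem_range.mp hk)
  clear_value c
  have hT := tendsto_qPoch q hq1
  have hTi := hT.inv₀ hL0
  have hlim : Tendsto (fun M => ∑' k, F M k) atTop (𝓝 (∑' k, c k * (L * (L⁻¹ * L⁻¹)))) := by
    refine tendsto_tsum_of_dominated_convergence (hbs.mul_right (K * (K' * K'))) (fun k => ?_)
      (Eventually.of_forall fun M k => ?_)
    · have e1 : Tendsto (fun M : ℕ => 2 * M + 1) atTop atTop :=
        tendsto_atTop_mono (fun M => by simp only [id]; omega) tendsto_id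
      have e2 : Tendsto (fun M : ℕ => M + 1 + k) atTop atTop :=
        tendsto_atTop_mono (fun M => by simp only [id]; omega) tendsto_id
      refine (((hT.comp e1).mul ((hTi.comp e2).mul
        (hTi.comp (tendsto_sub_atTop_nat k)))).const_mul (c k)).congr' ?_
      filter_upwards [eventually_ge_atTop k] with M hM
      simp only [F, if_pos (Nat.lt_succ_of_le hM), Function.comp]
    · simp only [F]
      split_ifs
      · rw [norm_mul, norm_mul, norm_mul]
        gcongr
        · exact hcb k
        · exact hK _
        · exact hK' _
        · exact hK' _
      · rw [norm_zero]; positivity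
  simp only [hF] at hlim
  have hlim2 := ((tendsto_qPoch y hq1).comp (tendsto_add_atTop_nat 1)).mul (tendsto_qPoch x hq1)
  have h := tendsto_nhds_unique hlim hlim2
  rw [tsum_mul_right] at h
  have : ∑' k, c k = qPochInf x q * qPochInf y q * L := by
    field_simp at h
    rw [h]; ring
  exact this ▸ hcs.hasSum

/-! ### The cubic Bailey pair -/

/-- The `α`-sequence of the Bailey pair relative to `q ^ 3`, up to the factor `1 - q ^ 3`. -/
noncomputable def baileyAlpha (q : ℂ) (k : ℕ) : ℂ :=
  if 3 ∣ k then (-1) ^ k * q ^ ((k + 1).choose 2) * (1 - q ^ (2 * k + 3)) else 0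

/-- The finite triple product at x = ζq^2, y = ζ^2/q with M = n + 1, multiplied by ζ^2 q. Its k = 0
term is split off because it cancels when summed over the three values of ζ. -/
theorem cubic_triple_product {q ζ : ℂ} (hq : q ≠ 0) (hq1 : ‖q‖ < 1) (hζ : ζ ^ 3 = 1) (n : ℕ) :
    (ζ ^ 2 * q - ζ)
        * (qPoch q q (2 * n + 3) * ((qPoch q q (n + 2))⁻¹ * (qPoch q q (n + 1))⁻¹))
      + ∑ k ∈ Finset.range (n + 1), (-1) ^ k * q ^ ((k + 1).choose 2)
        * (ζ ^ (2 * k) - ζ ^ k * q ^ (2 * k + 3))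
        * (qPoch q q (2 * n + 3) * ((qPoch q q (n + 3 + k))⁻¹ * (qPoch q q (n - k))⁻¹))
      = (1 - ζ) * (qPoch (ζ * q) q n * qPoch (ζ ^ 2 * q) q n)
        * ((1 - ζ * q ^ (n + 1)) * (1 - ζ * q ^ (n + 2))) := by
  have h := finite_triple_product_div hq hq1 (x := ζ * q ^ 2) (y := ζ ^ 2 * q⁻¹)
    (by field_simp; exact hζ) (n + 1)
  have hy : qPoch (ζ ^ 2 * q⁻¹) q (n + 1 + 1)
      = (1 - ζ ^ 2 * q⁻¹) * ((1 - ζ ^ 2) * qPoch (ζ ^ 2 * q) q n) := by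
    rw [qPoch_succ', qPoch_succ', show ζ ^ 2 * q⁻¹ * q = ζ ^ 2 by field_simp]
  have hx : (1 - ζ * q) * qPoch (ζ * q ^ 2) q (n + 1)
      = qPoch (ζ * q) q n * (1 - ζ * q ^ (n + 1)) * (1 - ζ * q ^ (n + 2)) := by
    rw [show ζ * q ^ 2 = ζ * q * q by ring, ← qPoch_succ', qPoch_succ, qPoch_succ]
    ring
  have hqi : q * q⁻¹ = 1 := mul_inv_cancel₀ hq
  rw [hy, Finset.sum_range_succ', ← sub_eq_zero] at h
  have hsum : ∑ k ∈ Finset.range (n + 1), (-1) ^ k * q ^ ((k + 1).choose 2)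
        * (ζ ^ (2 * k) - ζ ^ k * q ^ (2 * k + 3))
        * (qPoch q q (2 * n + 3) * ((qPoch q q (n + 3 + k))⁻¹ * (qPoch q q (n - k))⁻¹))
      = ζ ^ 2 * q * ∑ k ∈ Finset.range (n + 1), (-1) ^ (k + 1) *
          ((ζ * q ^ 2) ^ (k + 1) * q ^ ((k + 1).choose 2)
            - (ζ ^ 2 * q⁻¹) ^ (k + 1 + 1) * q ^ ((k + 1 + 1).choose 2)) *
          (qPoch q q (2 * (n + 1) + 1) * ((qPoch q q (n + 1 + 1 + (k + 1)))⁻¹ *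
            (qPoch q q (n + 1 - (k + 1)))⁻¹)) := by
    rw [Finset.mul_sum]
    refine Finset.sum_congr rfl fun k _ => ?_
    rw [show 2 * (n + 1) + 1 = 2 * n + 3 by ring, show n + 1 + 1 + (k + 1) = n + 3 + k by ring,
      show n + 1 - (k + 1) = n - k by omega, Nat.choose_succ_succ' (k + 1) 1,
      Nat.choose_one_right]
    have e1 : ζ ^ 2 * (ζ * q ^ 2) ^ (k + 1) * q = ζ ^ k * q ^ (2 * k + 3) := by
      linear_combination (ζ ^ k * q ^ (2 * k + 3)) * hζ
    have e2 : ζ ^ 2 * q * ((ζ ^ 2 * q⁻¹) ^ (k + 1 + 1) * q ^ (k + 1)) = ζ ^ (2 * k) := by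
      have : (q⁻¹) ^ (k + 2) * q ^ (k + 2) = 1 := by
        rw [← mul_pow, inv_mul_cancel₀ hq, one_pow]
      linear_combination ζ ^ (2 * k + 6) * this + ζ ^ (2 * k) * (ζ ^ 3 + 1) * hζ
    rw [← e1, ← e2, pow_add q (k + 1)]
    simp only [Nat.reduceAdd]
    ring
  rw [hsum]
  simp only [Nat.sub_zero, Nat.add_zero, pow_zero, zero_add, Nat.choose_zero_succ, pow_one,
    one_mul, Nat.choose_succ_self, mul_one] at h
  rw [show 2 * (n + 1) + 1 = 2 * n + 3 by ring] at *
  simp only [show n + 1 + 1 = n + 2 by ring] at *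
  set A := qPoch q q (2 * n + 3) * ((qPoch q q (n + 2))⁻¹ * (qPoch q q (n + 1))⁻¹)
  set X := qPoch (ζ ^ 2 * q) q n
  set Y := qPoch (ζ * q ^ 2) q (n + 1)
  linear_combination ζ ^ 2 * q * h + (ζ ^ 4 * A - ζ ^ 4 * (1 - ζ ^ 2) * X * Y) * hqi
    + (1 - ζ) * X * hx + (ζ * A + X * Y * (1 - ζ + ζ ^ 3 - ζ * q)) * hζ

theorem one_add_pow_add_pow {ω : ℂ} (hω : ω ^ 2 + ω + 1 = 0) (k : ℕ) :
    1 + ω ^ k + ω ^ (2 * k) = if 3 ∣ k then 3 else 0 := by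
  have h3 : ω ^ 3 = 1 := by linear_combination (ω - 1) * hω
  obtain ⟨d, r, hr, rfl⟩ : ∃ d r, r < 3 ∧ k = 3 * d + r :=
    ⟨k / 3, k % 3, Nat.mod_lt _ (by norm_num), by omega⟩
  have e1 : ω ^ (3 * d + r) = ω ^ r := by rw [pow_add, pow_mul, h3, one_pow, one_mul]
  have e2 : ω ^ (2 * (3 * d + r)) = ω ^ (2 * r) := by
    rw [show 2 * (3 * d + r) = 3 * (2 * d) + 2 * r by ring, pow_add, pow_mul, h3, one_pow, one_mul]
  rw [e1, e2]
  interval_cases r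
  · simp; norm_num
  · rw [if_neg (by omega)]; linear_combination hω
  · rw [if_neg (by omega)]; linear_combination hω + ω * h3

theorem qPoch_cube {q ω : ℂ} (hω : ω ^ 2 + ω + 1 = 0) (n : ℕ) :
    qPoch (q ^ 3) (q ^ 3) n = qPoch q q n * (qPoch (ω * q) q n * qPoch (ω ^ 2 * q) q n) := by
  have h3 : ω ^ 3 = 1 := by linear_combination (ω - 1) * hω
  simp only [qPoch, ← Finset.prod_mul_distrib]
  refine Finset.prod_congr rfl fun k _ => ?_
  set t := q * q ^ k with ht
  rw [show q ^ 3 * (q ^ 3) ^ k = t ^ 3 by rw [ht]; ring,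
    show ω * q * q ^ k = ω * t by rw [ht]; ring,
    show ω ^ 2 * q * q ^ k = ω ^ 2 * t by rw [ht]; ring]
  linear_combination (t ^ 3 - t ^ 2) * h3 + (t - t ^ 2) * hω

theorem exists_cube_root : ∃ ω : ℂ, ω ^ 2 + ω + 1 = 0 := by
  have h := (Complex.isPrimitiveRoot_exp 3 (by norm_num)).geom_sum_eq_zero (by norm_num)
  simp only [Finset.sum_range_succ, Finset.sum_range_zero] at h
  exact ⟨_, by linear_combination h⟩

theorem qPoch_add_two (q : ℂ) (n : ℕ) :
    qPoch q q (n + 2) = (1 - q) * (1 - q ^ 2) * qPoch (q ^ 3) q n := by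
  rw [qPoch_succ', qPoch_succ', show q * q * q = q ^ 3 by ring]
  ring

/-- The Bailey pair relative to `q ^ 3`. -/
theorem sum_baileyAlpha {q : ℂ} (hq : q ≠ 0) (hq1 : ‖q‖ < 1) (n : ℕ) :
    ∑ k ∈ Finset.range (n + 1),
        baileyAlpha q k * ((qPoch q q (n - k))⁻¹ * (qPoch (q ^ 3) q (n + k + 1))⁻¹)
      = qPoch (q ^ 3) (q ^ 3) n / (qPoch q q n * qPoch (q ^ 3) q (2 * n)) := by
  obtain ⟨ω, hω⟩ := exists_cube_root
  have h3 : ω ^ 3 = 1 := by linear_combination (ω - 1) * hω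
  have h6 : (ω ^ 2) ^ 3 = 1 := by linear_combination (ω ^ 3 + 1) * h3
  have E1 := cubic_triple_product hq hq1 (ζ := 1) (by norm_num) n
  have E2 := cubic_triple_product hq hq1 h3 n
  have E3 := cubic_triple_product hq hq1 h6 n
  have hq2 : ‖q ^ 2‖ < 1 := by simpa using pow_lt_one₀ (norm_nonneg q) hq1 two_ne_zero
  have hq3 : ‖q ^ 3‖ < 1 := by simpa using pow_lt_one₀ (norm_nonneg q) hq1 three_ne_zero
  have n1 := one_sub_ne_zero_of_norm_lt_one hq1
  have n2 := one_sub_ne_zero_of_norm_lt_one hq2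
  -- Sum over ζ = 1, ω, ω^2. The isolated terms add to zero, the right side vanishes at ζ = 1, and
  -- the other two right sides share the product of the ω- and ω^2-factorials.
  have hsum : 3 * (qPoch (q ^ 3) q (2 * n + 1) * ∑ k ∈ Finset.range (n + 1),
        baileyAlpha q k * ((qPoch q q (n - k))⁻¹ * (qPoch (q ^ 3) q (n + k + 1))⁻¹))
      = 3 * (qPoch (ω * q) q n * qPoch (ω ^ 2 * q) q n * (1 - q ^ (2 * n + 3))) := by
    have hω4 : qPoch ((ω ^ 2) ^ 2 * q) q n = qPoch (ω * q) q n := by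
      rw [show (ω ^ 2) ^ 2 = ω by linear_combination ω * h3]
    rw [hω4] at E3
    have key : ∑ k ∈ Finset.range (n + 1), ((-1) ^ k * q ^ ((k + 1).choose 2)
        * (1 ^ (2 * k) - 1 ^ k * q ^ (2 * k + 3))
        * (qPoch q q (2 * n + 3) * ((qPoch q q (n + 3 + k))⁻¹ * (qPoch q q (n - k))⁻¹))
        + (-1) ^ k * q ^ ((k + 1).choose 2)
        * (ω ^ (2 * k) - ω ^ k * q ^ (2 * k + 3))
        * (qPoch q q (2 * n + 3) * ((qPoch q q (n + 3 + k))⁻¹ * (qPoch q q (n - k))⁻¹))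
        + (-1) ^ k * q ^ ((k + 1).choose 2)
        * ((ω ^ 2) ^ (2 * k) - (ω ^ 2) ^ k * q ^ (2 * k + 3))
        * (qPoch q q (2 * n + 3) * ((qPoch q q (n + 3 + k))⁻¹ * (qPoch q q (n - k))⁻¹)))
        = 3 * (qPoch (q ^ 3) q (2 * n + 1) * ∑ k ∈ Finset.range (n + 1),
        baileyAlpha q k * ((qPoch q q (n - k))⁻¹ * (qPoch (q ^ 3) q (n + k + 1))⁻¹)) := by
      rw [Finset.mul_sum, Finset.mul_sum]
      refine Finset.sum_congr rfl fun k _ => ?_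
      have s := one_add_pow_add_pow hω k
      have e4 : (ω ^ 2) ^ (2 * k) = ω ^ k := by
        rw [← pow_mul, show 2 * (2 * k) = 3 * k + k by ring, pow_add, pow_mul, h3]; simp
      rw [e4, ← pow_mul ω 2 k, show 2 * n + 3 = 2 * n + 1 + 2 by ring, qPoch_add_two,
        show n + 3 + k = n + k + 1 + 2 by ring, qPoch_add_two]
      have n3 := qPoch_ne_zero hq1 hq3 (n + k + 1)
      have n4 := qPoch_ne_zero hq1 hq1 (n - k)
      have n5 : 1 - q ^ 2 ≠ 0 := n2
      have cancel : (1 - q) * (1 - q ^ 2) * qPoch (q ^ 3) q (2 * n + 1) *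
          (((1 - q) * (1 - q ^ 2) * qPoch (q ^ 3) q (n + k + 1))⁻¹ * (qPoch q q (n - k))⁻¹)
          = qPoch (q ^ 3) q (2 * n + 1) *
            ((qPoch (q ^ 3) q (n + k + 1))⁻¹ * (qPoch q q (n - k))⁻¹) := by
        field_simp
      rw [cancel, baileyAlpha]
      split_ifs at s ⊢ with hk
      · linear_combination (-1) ^ k * q ^ ((k + 1).choose 2) * (1 - q ^ (2 * k + 3)) *
          (qPoch (q ^ 3) q (2 * n + 1) *
            ((qPoch (q ^ 3) q (n + k + 1))⁻¹ * (qPoch q q (n - k))⁻¹)) * s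
      · linear_combination (-1) ^ k * q ^ ((k + 1).choose 2) * (1 - q ^ (2 * k + 3)) *
          (qPoch (q ^ 3) q (2 * n + 1) *
            ((qPoch (q ^ 3) q (n + k + 1))⁻¹ * (qPoch q q (n - k))⁻¹)) * s
    rw [← key, Finset.sum_add_distrib, Finset.sum_add_distrib]
    set A := qPoch q q (2 * n + 3) * ((qPoch q q (n + 2))⁻¹ * (qPoch q q (n + 1))⁻¹)
    set U := qPoch (ω * q) q n
    set V := qPoch (ω ^ 2 * q) q n
    have r : (1 - ω) * ((1 - ω * q ^ (n + 1)) * (1 - ω * q ^ (n + 2))) +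
        (1 - ω ^ 2) * ((1 - ω ^ 2 * q ^ (n + 1)) * (1 - ω ^ 2 * q ^ (n + 2)))
        = 3 * (1 - q ^ (2 * n + 3)) := by
      have e : q ^ (2 * n + 3) = q ^ (n + 1) * q ^ (n + 2) := by rw [← pow_add]; congr 1; ring
      rw [e]
      set B := q ^ (n + 1)
      set C := q ^ (n + 2)
      linear_combination (B * C - 1) * hω
        + (ω * (B + C) - (B * C) * (ω ^ 3 + 2) + B * C * ω) * h3
    linear_combination E1 + E2 + E3 + U * V * r - A * (q * ω ^ 2 - q * ω + q - 1) * hω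
  have hsum' := mul_left_cancel₀ three_ne_zero hsum
  have n6 := qPoch_ne_zero hq1 hq3 (2 * n)
  have n7 := qPoch_ne_zero hq1 hq1 n
  rw [qPoch_cube hω, eq_div_iff (mul_ne_zero n7 n6)]
  -- This is the last factor of (q^3;q)_{2n+1}; cancelling it leaves (q^3;q)_{2n}.
  have hne : 1 - q ^ (2 * n + 3) ≠ 0 := one_sub_ne_zero_of_norm_lt_one (by
    simpa using pow_lt_one₀ (norm_nonneg q) hq1 (by omega))
  refine mul_right_cancel₀ hne ?_
  rw [qPoch_succ, show q ^ 3 * q ^ (2 * n) = q ^ (2 * n + 3) by ring] at hsum'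
  linear_combination qPoch q q n * hsum'

/-! ### The q-Gauss sum -/

theorem exists_norm_homPoch_mul_le {a b t q : ℂ} (hq : ‖q‖ < 1) (h : ‖a * b * t‖ < 1) :
    ∃ K ρ : ℝ, 0 < K ∧ 0 ≤ ρ ∧ ρ < 1 ∧
      ∀ n, ‖homPoch a q n * homPoch b q n * t ^ n‖ ≤ K * ρ ^ n := by
  -- The strict inequality leaves room to enlarge both radii; positive radii are needed to cover a =
  -- 0 or b = 0.
  obtain ⟨ε, hε1, hε0⟩ : ∃ ε : ℝ, (‖a‖ + ε) * (‖b‖ + ε) * ‖t‖ < 1 ∧ 0 < ε := by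
    have hc : Tendsto (fun ε : ℝ => (‖a‖ + ε) * (‖b‖ + ε) * ‖t‖) (𝓝[>] 0)
        (𝓝 ((‖a‖ + 0) * (‖b‖ + 0) * ‖t‖)) :=
      (Continuous.tendsto (by fun_prop) 0).mono_left nhdsWithin_le_nhds
    have h1 : (‖a‖ + 0) * (‖b‖ + 0) * ‖t‖ < 1 := by simpa [norm_mul] using h
    exact ((hc.eventually_lt_const h1).and self_mem_nhdsWithin).exists
  obtain ⟨K, hK0, hK⟩ := exists_norm_homPoch_le (a := a) hq (ρ := ‖a‖ + ε)
    (by positivity) (by linarith)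
  obtain ⟨K', hK0', hK'⟩ := exists_norm_homPoch_le (a := b) hq (ρ := ‖b‖ + ε)
    (by positivity) (by linarith)
  refine ⟨K * K', _, by positivity, by positivity, hε1, fun n => ?_⟩
  rw [norm_mul, norm_mul, norm_pow]
  calc _ ≤ (K * (‖a‖ + ε) ^ n) * (K' * (‖b‖ + ε) ^ n) * ‖t‖ ^ n := by
        gcongr
        · exact hK n
        · exact hK' n
    _ = _ := by rw [mul_pow, mul_pow]; ring

/-- The general term of the `q`-Gauss series. -/
noncomputable def gaussTerm (a b q t : ℂ) (m : ℕ) : ℂ :=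
  homPoch a q m * homPoch b q m * t ^ m * ((qPoch q q m)⁻¹ * (qPoch (t * q ^ 2) q m)⁻¹)

theorem summable_gaussTerm {a b q t : ℂ} (hq : ‖q‖ < 1) (ht : ‖t * q ^ 2‖ < 1)
    (h : ‖a * b * t‖ < 1) : Summable (gaussTerm a b q t) := by
  obtain ⟨K, ρ, hK0, hρ0, hρ1, hK⟩ := exists_norm_homPoch_mul_le hq h
  obtain ⟨K1, hK10, hK1⟩ := exists_norm_inv_qPoch_le hq hq
  obtain ⟨K2, hK20, hK2⟩ := exists_norm_inv_qPoch_le hq ht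
  refine Summable.of_norm_bounded
    (((summable_geometric_of_lt_one hρ0 hρ1).mul_left K).mul_right (K1 * K2)) fun m => ?_
  rw [gaussTerm, norm_mul, norm_mul (qPoch q q m)⁻¹]
  gcongr
  · exact hK m
  · exact hK1 m
  · exact hK2 m

/-- A telescoping certificate: the right side is G(m+1) - G(m), where G vanishes at m = 0 through 1
- q^0 and tends to 0 when the series converges. Summation over m gives the relation between t and
tq. -/
theorem gaussTerm_contiguous {a b q t : ℂ} (hq : ‖q‖ < 1) (ht : ‖t * q ^ 2‖ < 1) (m : ℕ) :
    (1 - t * q ^ 2) * (1 - a * b * t) * gaussTerm a b q t m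
        - (1 - a * t * q) * (1 - b * t * q) * gaussTerm a b q (t * q) m
      = -((1 - t * q ^ 2) * (1 - q ^ (m + 1)) * gaussTerm a b q t (m + 1))
        - -((1 - t * q ^ 2) * (1 - q ^ m) * gaussTerm a b q t m) := by
  have h0 := one_sub_ne_zero_of_norm_lt_one ht
  have h1 := one_sub_ne_zero_of_norm_lt_one (norm_mul_pow_lt_one hq ht m)
  have h2 := one_sub_ne_zero_of_norm_lt_one (norm_mul_pow_lt_one hq hq m)
  have h3 := qPoch_ne_zero hq hq m
  have h4 := qPoch_ne_zero hq ht m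
  have hp : qPoch (t * q * q ^ 2) q m
      = qPoch (t * q ^ 2) q m * (1 - t * q ^ 2 * q ^ m) / (1 - t * q ^ 2) := by
    rw [eq_div_iff h0, ← qPoch_succ, qPoch_succ', show t * q ^ 2 * q = t * q * q ^ 2 by ring]
    ring
  have hP : ∀ c : ℂ, homPoch c q (m + 1) = homPoch c q m * (c - q * q ^ m) := fun c => by
    rw [homPoch, Finset.prod_range_succ, ← homPoch, pow_succ']
  rw [gaussTerm, gaussTerm, gaussTerm, hp, hP, hP, qPoch_succ, qPoch_succ, mul_pow,
    pow_succ' q m, pow_succ t m]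
  generalize homPoch a q m = A at *
  generalize homPoch b q m = B at *
  generalize qPoch q q m = X at *
  generalize qPoch (t * q ^ 2) q m = Y at *
  generalize q ^ m = Q at *
  generalize t ^ m = T at *
  field_simp
  ring

theorem tsum_gaussTerm_contiguous {a b q t : ℂ} (hq : ‖q‖ < 1) (ht : ‖t * q ^ 2‖ < 1)
    (h : ‖a * b * t‖ < 1) :
    (1 - t * q ^ 2) * (1 - a * b * t) * ∑' m, gaussTerm a b q t m
      = (1 - a * t * q) * (1 - b * t * q) * ∑' m, gaussTerm a b q (t * q) m := by
  have hs := summable_gaussTerm hq ht h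
  have hs' : Summable (gaussTerm a b q (t * q)) := by
    refine summable_gaussTerm hq ?_ ?_
    · simpa [mul_right_comm] using norm_mul_pow_lt_one hq ht 1
    · simpa [mul_assoc] using norm_mul_pow_lt_one hq h 1
  have hpow : Tendsto (fun m : ℕ => q ^ m) atTop (𝓝 0) := tendsto_pow_atTop_nhds_zero_of_norm_lt_one hq
  have hG : Tendsto (fun m => -((1 - t * q ^ 2) * (1 - q ^ m) * gaussTerm a b q t m)) atTop
      (𝓝 (-((1 - t * q ^ 2) * (1 - 0) * 0))) :=
    (((hpow.const_sub 1).const_mul _).mul hs.tendsto_atTop_zero).neg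
  have hd := (hs.mul_left ((1 - t * q ^ 2) * (1 - a * b * t))).hasSum.sub
    (hs'.mul_left ((1 - a * t * q) * (1 - b * t * q))).hasSum
  have h0 := hd.tendsto_sum_nat
  simp only [gaussTerm_contiguous hq ht] at h0
  simp only [Finset.sum_range_sub (fun m => -((1 - t * q ^ 2) * (1 - q ^ m) * gaussTerm a b q t m))]
    at h0
  have := tendsto_nhds_unique h0 (hG.sub_const _)
  rw [tsum_mul_left, tsum_mul_left] at this
  simpa [sub_eq_zero] using this

theorem tsum_gaussTerm_iterate {a b q t : ℂ} (hq : ‖q‖ < 1) (ht : ‖t * q ^ 2‖ < 1)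
    (h : ‖a * b * t‖ < 1) (N : ℕ) :
    qPoch (t * q ^ 2) q N * qPoch (a * b * t) q N * ∑' m, gaussTerm a b q t m
      = qPoch (a * t * q) q N * qPoch (b * t * q) q N * ∑' m, gaussTerm a b q (t * q ^ N) m := by
  induction N with
  | zero => simp [qPoch_zero]
  | succ N ih =>
    have h1 := tsum_gaussTerm_contiguous (a := a) (b := b) (t := t * q ^ N) hq
      (by simpa [mul_right_comm] using norm_mul_pow_lt_one hq ht N)
      (by simpa [mul_assoc] using norm_mul_pow_lt_one hq h N)
    rw [show t * q ^ (N + 1) = t * q ^ N * q by ring, qPoch_succ, qPoch_succ, qPoch_succ,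
      qPoch_succ]
    linear_combination (1 - t * q ^ 2 * q ^ N) * (1 - a * b * t * q ^ N) * ih
      + qPoch (a * t * q) q N * qPoch (b * t * q) q N * h1

theorem tendsto_tsum_gaussTerm {a b q t : ℂ} (hq : ‖q‖ < 1) (ht : ‖t * q ^ 2‖ < 1)
    (h : ‖a * b * t‖ < 1) :
    Tendsto (fun N : ℕ => ∑' m, gaussTerm a b q (t * q ^ N) m) atTop (𝓝 1) := by
  obtain ⟨K, ρ, hK0, hρ0, hρ1, hK⟩ := exists_norm_homPoch_mul_le hq h
  obtain ⟨K1, hK10, hK1⟩ := exists_norm_inv_qPoch_le hq hq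
  obtain ⟨K2, hK20, hK2⟩ := exists_norm_inv_qPoch_le hq ht
  obtain ⟨K3, hK30, hK3⟩ := exists_norm_qPoch_le (t * q ^ 2) hq
  have hpow : Tendsto (fun m : ℕ => q ^ m) atTop (𝓝 0) := tendsto_pow_atTop_nhds_zero_of_norm_lt_one hq
  -- The N-dependent denominator becomes a ratio of factorials with one fixed parameter, hence is
  -- bounded uniformly in N and m. The remaining factor q^(Nm) leaves only m = 0 in the limit.
  have hinv : ∀ N m, (qPoch (t * q ^ N * q ^ 2) q m)⁻¹
      = qPoch (t * q ^ 2) q N * (qPoch (t * q ^ 2) q (N + m))⁻¹ := fun N m => by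
    rw [qPoch_add, mul_right_comm t (q ^ N), mul_inv, mul_inv_cancel_left₀ (qPoch_ne_zero hq ht N)]
  have hterm : ∀ N m, gaussTerm a b q (t * q ^ N) m
      = homPoch a q m * homPoch b q m * t ^ m * (qPoch q q m)⁻¹ *
        ((q ^ N) ^ m * (qPoch (t * q ^ 2) q N * (qPoch (t * q ^ 2) q (N + m))⁻¹)) := fun N m => by
    rw [gaussTerm, hinv, mul_pow]; ring
  have hone : ∑' m : ℕ, (if m = 0 then (1 : ℂ) else 0) = 1 := by simp
  rw [← hone]
  refine tendsto_tsum_of_dominated_convergence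
    ((((summable_geometric_of_lt_one hρ0 hρ1).mul_left K).mul_right K1).mul_right
      (1 * (K3 * K2))) (fun m => ?_) (Eventually.of_forall fun N m => ?_)
  · have hT := tendsto_qPoch (t * q ^ 2) hq
    have hc := hT.mul (((hT.comp (tendsto_add_atTop_nat m))).inv₀ (qPochInf_ne_zero hq ht))
    have := ((hpow.pow m).mul hc).const_mul
      (homPoch a q m * homPoch b q m * t ^ m * (qPoch q q m)⁻¹)
    rw [mul_inv_cancel₀ (qPochInf_ne_zero hq ht)] at this
    simp only [hterm]
    have hv : (if m = 0 then (1 : ℂ) else 0)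
        = homPoch a q m * homPoch b q m * t ^ m * (qPoch q q m)⁻¹ * (0 ^ m * 1) := by
      split_ifs with hm
      · subst hm; simp [homPoch, qPoch_zero]
      · simp [hm]
    rw [hv]
    exact this
  · rw [hterm, norm_mul, norm_mul _ (qPoch q q m)⁻¹, norm_mul ((q ^ N) ^ m),
      norm_mul (qPoch (t * q ^ 2) q N)]
    gcongr
    · exact hK m
    · exact hK1 m
    · rw [norm_pow, norm_pow]
      exact pow_le_one₀ (by positivity) (pow_le_one₀ (norm_nonneg q) hq.le)
    · exact hK3 N
    · exact hK2 _

/-- The `q`-Gauss sum. -/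
theorem hasSum_gaussTerm {a b q t : ℂ} (hq : ‖q‖ < 1) (ht : ‖t * q ^ 2‖ < 1)
    (h : ‖a * b * t‖ < 1) :
    HasSum (gaussTerm a b q t) (qPochInf (a * t * q) q * qPochInf (b * t * q) q
      / (qPochInf (t * q ^ 2) q * qPochInf (a * b * t) q)) := by
  have h1 := ((tendsto_qPoch (t * q ^ 2) hq).mul (tendsto_qPoch (a * b * t) hq)).mul_const
    (∑' m, gaussTerm a b q t m)
  simp only [tsum_gaussTerm_iterate hq ht h] at h1
  have h2 := ((tendsto_qPoch (a * t * q) hq).mul (tendsto_qPoch (b * t * q) hq)).mul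
    (tendsto_tsum_gaussTerm hq ht h)
  have h3 := tendsto_nhds_unique h1 h2
  have n1 := qPochInf_ne_zero hq ht
  have n2 := qPochInf_ne_zero hq h
  have : ∑' m, gaussTerm a b q t m = qPochInf (a * t * q) q * qPochInf (b * t * q) q
      / (qPochInf (t * q ^ 2) q * qPochInf (a * b * t) q) := by
    rw [eq_div_iff (mul_ne_zero n1 n2)]
    linear_combination h3
  exact this ▸ (summable_gaussTerm hq ht h).hasSum

/-! ### Bailey's lemma by double summation -/

theorem homPoch_add {q : ℂ} (hq : q ≠ 0) (a : ℂ) (k m : ℕ) :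
    homPoch a q (k + m) = homPoch a q k * ((q ^ k) ^ m * homPoch (a * (q⁻¹) ^ k) q m) := by
  have hk : q ^ k * (q⁻¹) ^ k = 1 := by rw [← mul_pow, mul_inv_cancel₀ hq, one_pow]
  rw [homPoch, Finset.prod_range_add, ← homPoch]
  congr 1
  rw [homPoch, show (q ^ k) ^ m = ∏ _j ∈ Finset.range m, q ^ k by simp, ← Finset.prod_mul_distrib]
  refine Finset.prod_congr rfl fun j _ => ?_
  linear_combination -a * hk

/-- The double series whose row sums and diagonal sums are compared in Bailey's lemma. -/
noncomputable def baileyTerm (a b q : ℂ) (p : ℕ × ℕ) : ℂ :=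
  baileyAlpha q p.1 * (homPoch a q (p.1 + p.2) * homPoch b q (p.1 + p.2) * (q ^ 2) ^ (p.1 + p.2))
    * ((qPoch q q p.2)⁻¹ * (qPoch (q ^ 3) q (2 * p.1 + 1 + p.2))⁻¹)

theorem norm_baileyAlpha_le {q : ℂ} (hq : ‖q‖ < 1) (k : ℕ) : ‖baileyAlpha q k‖ ≤ 2 := by
  have hp : ∀ m, ‖q ^ m‖ ≤ 1 := fun m => by
    rw [norm_pow]; exact pow_le_one₀ (norm_nonneg q) hq.le
  rw [baileyAlpha]
  split_ifs
  · rw [norm_mul, norm_mul, norm_pow, norm_neg, norm_one, one_pow, one_mul]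
    have h1 : ‖1 - q ^ (2 * k + 3)‖ ≤ 2 := by
      refine (norm_sub_le _ _).trans ?_
      rw [norm_one]
      linarith [hp (2 * k + 3)]
    calc _ ≤ 1 * (2 : ℝ) := mul_le_mul (hp _) h1 (norm_nonneg _) zero_le_one
      _ = 2 := one_mul 2
  · simp

theorem summable_baileyTerm {a b q : ℂ} (hq : ‖q‖ < 1) (h : ‖a * b * q ^ 2‖ < 1) :
    Summable (baileyTerm a b q) := by
  have hq3 : ‖q ^ 3‖ < 1 := by simpa using pow_lt_one₀ (norm_nonneg q) hq three_ne_zero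
  obtain ⟨K, ρ, hK0, hρ0, hρ1, hK⟩ := exists_norm_homPoch_mul_le hq h
  obtain ⟨K1, hK10, hK1⟩ := exists_norm_inv_qPoch_le hq hq
  obtain ⟨K2, hK20, hK2⟩ := exists_norm_inv_qPoch_le hq hq3
  have hg := summable_geometric_of_lt_one hρ0 hρ1
  have hs : Summable fun p : ℕ × ℕ => ρ ^ p.1 * ρ ^ p.2 :=
    hg.mul_of_nonneg hg (fun _ => by positivity) (fun _ => by positivity)
  refine Summable.of_norm_bounded (((hs.mul_left K).mul_left 2).mul_right (K1 * K2)) fun p => ?_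
  rw [baileyTerm, norm_mul, norm_mul (baileyAlpha q p.1), norm_mul (qPoch q q p.2)⁻¹]
  gcongr
  · exact norm_baileyAlpha_le hq _
  · rw [← pow_add]; exact hK _
  · exact hK1 _
  · exact hK2 _

/-- Row k is a q-Gauss series with parameters a q^(-k), b q^(-k) and t = q^(2k+2). The product of
the three is always abq^2, so one convergence condition serves every row. -/
theorem hasSum_baileyTerm_row {a b q : ℂ} (hq0 : q ≠ 0) (hq : ‖q‖ < 1)
    (ha : ‖a * q ^ 3‖ < 1) (hb : ‖b * q ^ 3‖ < 1) (h : ‖a * b * q ^ 2‖ < 1) (k : ℕ) :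
    HasSum (fun m => baileyTerm a b q (k, m))
      (qPochInf (a * q ^ 3) q * qPochInf (b * q ^ 3) q
          / (qPochInf (q ^ 3) q * qPochInf (a * b * q ^ 2) q)
        * (baileyAlpha q k * (homPoch a q k * homPoch b q k * (q ^ 2) ^ k)
          * ((qPoch (a * q ^ 3) q k)⁻¹ * (qPoch (b * q ^ 3) q k)⁻¹))) := by
  have hq3 : ‖q ^ 3‖ < 1 := by simpa using pow_lt_one₀ (norm_nonneg q) hq three_ne_zero
  have hk : q ^ k * (q⁻¹) ^ k = 1 := by rw [← mul_pow, mul_inv_cancel₀ hq0, one_pow]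
  have et : q ^ (2 * k + 2) * q ^ 2 = q ^ 3 * q ^ (2 * k + 1) := by ring
  have eabt : a * (q⁻¹) ^ k * (b * (q⁻¹) ^ k) * q ^ (2 * k + 2) = a * b * q ^ 2 := by
    linear_combination a * b * q ^ 2 * (q ^ k * (q⁻¹) ^ k + 1) * hk
  have ea : ∀ c, c * (q⁻¹) ^ k * q ^ (2 * k + 2) * q = c * q ^ 3 * q ^ k := fun c => by
    linear_combination c * q ^ (k + 3) * hk
  have hg := hasSum_gaussTerm (a := a * (q⁻¹) ^ k) (b := b * (q⁻¹) ^ k) (t := q ^ (2 * k + 2)) hq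
    (by rw [et]; exact norm_mul_pow_lt_one hq hq3 _) (by rw [eabt]; exact h)
  rw [et, eabt, ea, ea] at hg
  have hg2 := hg.mul_left (baileyAlpha q k * (homPoch a q k * homPoch b q k * (q ^ 2) ^ k)
    * (qPoch (q ^ 3) q (2 * k + 1))⁻¹)
  have hv : qPochInf (a * q ^ 3) q * qPochInf (b * q ^ 3) q
          / (qPochInf (q ^ 3) q * qPochInf (a * b * q ^ 2) q)
        * (baileyAlpha q k * (homPoch a q k * homPoch b q k * (q ^ 2) ^ k)
          * ((qPoch (a * q ^ 3) q k)⁻¹ * (qPoch (b * q ^ 3) q k)⁻¹))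
      = baileyAlpha q k * (homPoch a q k * homPoch b q k * (q ^ 2) ^ k)
        * (qPoch (q ^ 3) q (2 * k + 1))⁻¹
        * (qPochInf (a * q ^ 3 * q ^ k) q * qPochInf (b * q ^ 3 * q ^ k) q
          / (qPochInf (q ^ 3 * q ^ (2 * k + 1)) q * qPochInf (a * b * q ^ 2) q)) := by
    rw [qPochInf_eq_qPoch_mul (a * q ^ 3) hq k, qPochInf_eq_qPoch_mul (b * q ^ 3) hq k,
      qPochInf_eq_qPoch_mul (q ^ 3) hq (2 * k + 1)]
    have n1 := qPoch_ne_zero hq ha k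
    have n2 := qPoch_ne_zero hq hb k
    generalize qPoch (a * q ^ 3) q k = X at *
    generalize qPoch (b * q ^ 3) q k = Y at *
    field_simp
  rw [hv]
  refine hg2.congr_fun fun m => ?_
  rw [baileyTerm, gaussTerm, et]
  simp only [homPoch_add hq0, qPoch_add (q ^ 3) q (2 * k + 1) m, mul_inv]
  ring

theorem sum_antidiagonal_baileyTerm {q : ℂ} (hq0 : q ≠ 0) (hq : ‖q‖ < 1) (a b : ℂ) (n : ℕ) :
    ∑ p ∈ Finset.HasAntidiagonal.antidiagonal n, baileyTerm a b q p
      = homPoch a q n * homPoch b q n * qPoch (q ^ 3) (q ^ 3) n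
        / (qPoch q q n * qPoch (q ^ 3) q (2 * n)) * q ^ (2 * n) := by
  rw [Finset.Nat.sum_antidiagonal_eq_sum_range_succ_mk]
  have h : ∀ k ∈ Finset.range (n + 1), baileyTerm a b q (k, n - k)
      = homPoch a q n * homPoch b q n * q ^ (2 * n) *
        (baileyAlpha q k * ((qPoch q q (n - k))⁻¹ * (qPoch (q ^ 3) q (n + k + 1))⁻¹)) :=
    fun k hk => by
      obtain ⟨d, rfl⟩ := Nat.exists_eq_add_of_le (Nat.lt_succ_iff.mp (Finset.mem_range.mp hk))
      rw [baileyTerm]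
      simp only [show k + d - k = d by omega, show 2 * k + 1 + d = k + d + k + 1 by ring]
      ring
  rw [Finset.sum_congr rfl h, ← Finset.mul_sum, sum_baileyAlpha hq0 hq]
  ring

/-- Row and antidiagonal sums of `baileyTerm` agree. Leaving the value S unspecified lets a triple
product evaluation be inserted later. -/
theorem exists_hasSum_bailey {a b q : ℂ} (hq0 : q ≠ 0) (hq : ‖q‖ < 1)
    (ha : ‖a * q ^ 3‖ < 1) (hb : ‖b * q ^ 3‖ < 1) (h : ‖a * b * q ^ 2‖ < 1) :
    ∃ S : ℂ, HasSum (fun r : ℕ => (-1) ^ r * q ^ ((3 * r + 1).choose 2) * (1 - q ^ (6 * r + 3))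
          * (homPoch a q (3 * r) * homPoch b q (3 * r) * q ^ (6 * r))
          / (qPoch (a * q ^ 3) q (3 * r) * qPoch (b * q ^ 3) q (3 * r))) S ∧
      HasSum (fun n : ℕ => homPoch a q n * homPoch b q n * qPoch (q ^ 3) (q ^ 3) n
        / (qPoch q q n * qPoch (q ^ 3) q (2 * n)) * q ^ (2 * n))
      (qPochInf (a * q ^ 3) q * qPochInf (b * q ^ 3) q
          / (qPochInf (q ^ 3) q * qPochInf (a * b * q ^ 2) q) * S) := by
  have hq3 : ‖q ^ 3‖ < 1 := by simpa using pow_lt_one₀ (norm_nonneg q) hq three_ne_zero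
  have hs := (summable_baileyTerm hq h).hasSum
  set T := ∑' p, baileyTerm a b q p
  set c := qPochInf (a * q ^ 3) q * qPochInf (b * q ^ 3) q
          / (qPochInf (q ^ 3) q * qPochInf (a * b * q ^ 2) q) with hc
  have hc0 : c ≠ 0 := div_ne_zero (mul_ne_zero (qPochInf_ne_zero hq ha) (qPochInf_ne_zero hq hb))
    (mul_ne_zero (qPochInf_ne_zero hq hq3) (qPochInf_ne_zero hq h))
  have hrow := (hs.prod_fiberwise (hasSum_baileyTerm_row hq0 hq ha hb h)).mul_left c⁻¹
  simp only [← hc, inv_mul_cancel_left₀ hc0] at hrow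
  refine ⟨c⁻¹ * T, ?_, ?_⟩
  -- The rows with 3 ∤ k are zero, so the sum is reindexed along k = 3r.
  · have hinj : Function.Injective fun r : ℕ => 3 * r := fun x y hxy => by
      simpa using hxy
    rw [← hinj.hasSum_iff] at hrow
    · refine hrow.congr_fun fun r => ?_
      simp only [Function.comp]
      rw [baileyAlpha, if_pos (dvd_mul_right 3 r), pow_mul (-1 : ℂ) 3 r, ← pow_mul q 2,
        show 2 * (3 * r) = 6 * r by ring, show ((-1 : ℂ)) ^ 3 = -1 by norm_num]
      field_simp
    · intro k hk
      have : ¬ 3 ∣ k := fun ⟨d, hd⟩ => hk ⟨d, hd.symm⟩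
      simp [baileyAlpha, this]
  · rw [mul_inv_cancel_left₀ hc0]
    have hd := (Finset.HasAntidiagonal.sigmaAntidiagonalEquivProd (A := ℕ)).hasSum_iff.mpr hs
    have hd2 := hd.sigma fun n => hasSum_fintype _
    refine hd2.congr_fun fun n => ?_
    rw [← sum_antidiagonal_baileyTerm hq0 hq]
    exact (Finset.sum_coe_sort (Finset.HasAntidiagonal.antidiagonal n) (baileyTerm a b q)).symm

/-! ### The two-parameter transformation -/

theorem sq_eq_two_mul_choose (n : ℕ) : n ^ 2 = 2 * n.choose 2 + n := by
  induction n with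
  | zero => rfl
  | succ n ih =>
    rw [Nat.choose_succ_succ' n 1, Nat.choose_one_right]
    linarith

theorem choose_two_succ (n : ℕ) : (n + 1).choose 2 = n.choose 2 + n := by
  rw [Nat.choose_succ_succ' n 1, Nat.choose_one_right, add_comm]

theorem choose_two_three_mul (n : ℕ) : (3 * n + 1).choose 2 = 9 * n.choose 2 + 6 * n := by
  induction n with
  | zero => rfl
  | succ n ih =>
    rw [show 3 * (n + 1) + 1 = 3 * n + 1 + 1 + 1 + 1 by ring, choose_two_succ, choose_two_succ,
      choose_two_succ, ih, choose_two_succ]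
    ring

theorem qPochInf_zero_left (q : ℂ) : qPochInf 0 q = 1 := by simp [qPochInf]

theorem qPoch_zero_left (q : ℂ) (n : ℕ) : qPoch 0 q n = 1 := by simp [qPoch]

theorem cubic_transformation {a b q : ℂ} (hq : ‖q‖ < 1) (ha0 : a ≠ 0) (hb0 : b ≠ 0)
    (ha : ‖a * q ^ 3‖ < 1) (hb : ‖b * q ^ 3‖ < 1) (h : ‖a * b * q ^ 2‖ < 1) :
    ∃ S : ℂ, HasSum (fun n : ℕ =>
        (-1 : ℂ) ^ n * (1 - q ^ (6 * n + 3))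
          * (qPoch (q / a) q (3 * n) * qPoch (q / b) q (3 * n)
            / (qPoch (a * q ^ 3) q (3 * n) * qPoch (b * q ^ 3) q (3 * n)))
          * (a * b) ^ (3 * n) * q ^ ((9 * n ^ 2 + 15 * n) / 2)) S ∧
      HasSum (fun n : ℕ =>
        qPoch (q / a) q n * qPoch (q / b) q n * qPoch (q ^ 3) (q ^ 3) n
          / (qPoch q q n * qPoch (q ^ 3) q (2 * n)) * (a * b) ^ n * q ^ (2 * n))
      (qPochInf (a * q ^ 3) q * qPochInf (b * q ^ 3) q
          / (qPochInf (q ^ 3) q * qPochInf (a * b * q ^ 2) q) * S) := by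
  -- The Bailey argument divides by q; at q = 0 both series reduce to their n = 0 term.
  rcases eq_or_ne q 0 with rfl | hq0
  · refine ⟨1, ?_, ?_⟩
    · convert hasSum_single (α := ℂ) 0 fun n hn => ?_ using 1
      · simp [qPoch_zero]
      · have : (9 * n ^ 2 + 15 * n) / 2 ≠ 0 := by
          have : 0 < n := Nat.pos_of_ne_zero hn
          omega
        simp [this]
    · convert hasSum_single (α := ℂ) 0 fun n hn => ?_ using 1
      · simp [qPoch_zero, qPochInf_zero_left]
      · simp [hn]
  · obtain ⟨S, h1, h2⟩ := exists_hasSum_bailey hq0 hq ha hb h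
    refine ⟨S, h1.congr_fun fun n => ?_, h2.congr_fun fun n => ?_⟩
    -- The natural-number division is exact.
    · have e : (9 * n ^ 2 + 15 * n) / 2 = (3 * n + 1).choose 2 + 6 * n := by
        rw [sq_eq_two_mul_choose, choose_two_three_mul]
        omega
      rw [homPoch_eq ha0, homPoch_eq hb0, e]
      ring
    · rw [homPoch_eq ha0, homPoch_eq hb0]
      ring

/-! ### Slater's identities -/

/-- The cubic summation in the form used for specialisations, `a = 0` and `b = 0` allowed. -/
theorem hasSum_slater {a b q S : ℂ} (hq0 : q ≠ 0) (hq : ‖q‖ < 1)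
    (ha : ‖a * q ^ 3‖ < 1) (hb : ‖b * q ^ 3‖ < 1) (h : ‖a * b * q ^ 2‖ < 1)
    (hS : HasSum (fun r : ℕ => (-1) ^ r * q ^ ((3 * r + 1).choose 2) * (1 - q ^ (6 * r + 3))
          * (homPoch a q (3 * r) * homPoch b q (3 * r) * q ^ (6 * r))
          / (qPoch (a * q ^ 3) q (3 * r) * qPoch (b * q ^ 3) q (3 * r))) S) :
    HasSum (fun n : ℕ => homPoch a q n * homPoch b q n * qPoch (q ^ 3) (q ^ 3) n
        / (qPoch q q n * qPoch q q (2 * n + 2)) * q ^ (2 * n))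
      (qPochInf (a * q ^ 3) q * qPochInf (b * q ^ 3) q
          / (qPochInf q q * qPochInf (a * b * q ^ 2) q) * S) := by
  obtain ⟨S', h1, h2⟩ := exists_hasSum_bailey hq0 hq ha hb h
  obtain rfl := h1.unique hS
  have hq2 : ‖q ^ 2‖ < 1 := by simpa using pow_lt_one₀ (norm_nonneg q) hq two_ne_zero
  have n1 := one_sub_ne_zero_of_norm_lt_one hq
  have n2 := one_sub_ne_zero_of_norm_lt_one hq2
  have e : qPochInf q q = (1 - q) * (1 - q ^ 2) * qPochInf (q ^ 3) q := by
    rw [qPochInf_eq_qPoch_mul q hq 2, show q * q ^ 2 = q ^ 3 by ring]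
    congr 1
    simp only [qPoch, Finset.prod_range_succ, Finset.prod_range_zero]
    ring
  have h3 := h2.mul_left ((1 - q) * (1 - q ^ 2))⁻¹
  have hv : qPochInf (a * q ^ 3) q * qPochInf (b * q ^ 3) q
          / (qPochInf q q * qPochInf (a * b * q ^ 2) q) * S'
      = ((1 - q) * (1 - q ^ 2))⁻¹ * (qPochInf (a * q ^ 3) q * qPochInf (b * q ^ 3) q
          / (qPochInf (q ^ 3) q * qPochInf (a * b * q ^ 2) q) * S') := by
    rw [e]; field_simp
  rw [hv]
  refine h3.congr_fun fun n => ?_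
  rw [qPoch_add_two]
  field_simp

theorem slater90 {q : ℂ} (hq : ‖q‖ < 1) :
    HasSum (fun n : ℕ =>
        qPoch (q ^ 3) (q ^ 3) n
          / (qPoch q q n * qPoch q q (2 * n + 2)) * q ^ (n ^ 2 + 3 * n))
      (qPochInf (q ^ 3) (q ^ 27) * qPochInf (q ^ 24) (q ^ 27) * qPochInf (q ^ 27) (q ^ 27)
        / qPochInf q q) := by
  rcases eq_or_ne q 0 with rfl | hq0
  · convert hasSum_single (α := ℂ) 0 fun n hn => ?_ using 1
    · simp [qPoch_zero, qPochInf_zero_left, qPoch_zero_left]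
    · simp [hn]
  have hp : ∀ m, m ≠ 0 → ‖q ^ m‖ < 1 := fun m hm => by
    simpa using pow_lt_one₀ (norm_nonneg q) hq hm
  -- The quotient of the two combined terms is q^(3r+3+27r-24r) = q^(6r+3), which reproduces the
  -- factor 1 - q^(6r+3).
  have hj := hasSum_triple_product (q := q ^ 27) (x := q ^ 24) (y := q ^ 3) (pow_ne_zero _ hq0)
    (hp _ (by norm_num)) (by ring) (hp _ (by norm_num)) (hp _ (by norm_num))
  have hs := hasSum_slater (a := 0) (b := 0) hq0 hq (by simp) (by simp) (by simp)
    (hj.congr_fun fun r => by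
      have s : ((-1 : ℂ) ^ (3 * r)) ^ 2 = 1 := by rw [← pow_mul, mul_comm, pow_mul]; simp
      simp only [homPoch_zero_left, zero_mul, qPoch_zero_left, choose_two_three_mul,
        choose_two_succ]
      linear_combination ((-1) ^ r * q ^ (9 * r.choose 2 + 6 * r) * (1 - q ^ (6 * r + 3)) *
        (q ^ (9 * r.choose 2 + 6 * r)) ^ 2 * q ^ (6 * r)) * s)
  have hv : qPochInf (0 * q ^ 3) q * qPochInf (0 * q ^ 3) q / (qPochInf q q *
        qPochInf (0 * 0 * q ^ 2) q) *
        (qPochInf (q ^ 24) (q ^ 27) * qPochInf (q ^ 3) (q ^ 27) * qPochInf (q ^ 27) (q ^ 27))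
      = qPochInf (q ^ 3) (q ^ 27) * qPochInf (q ^ 24) (q ^ 27) * qPochInf (q ^ 27) (q ^ 27)
        / qPochInf q q := by
    simp only [zero_mul, qPochInf_zero_left]
    ring
  rw [hv] at hs
  refine hs.congr_fun fun n => ?_
  have s : ((-1 : ℂ) ^ n) ^ 2 = 1 := by rw [← pow_mul, mul_comm, pow_mul]; simp
  simp only [homPoch_zero_left, choose_two_succ, sq_eq_two_mul_choose n]
  linear_combination (-(q ^ (n.choose 2 + n)) ^ 2 * qPoch (q ^ 3) (q ^ 3) n
    / (qPoch q q n * qPoch q q (2 * n + 2)) * q ^ (2 * n)) * s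

theorem neg_one_pow_mul_inv_pow {q : ℂ} (hq0 : q ≠ 0) (n : ℕ) :
    (-1) ^ n * (-q⁻¹) ^ n * q ^ n = 1 := by
  rw [← mul_pow, ← mul_pow]
  simp [hq0]

theorem slater76 {q : ℂ} (hq : ‖q‖ < 1) :
    HasSum (fun n : ℕ =>
        qPoch (-q) q (n + 1) * qPoch (q ^ 3) (q ^ 3) n
          / (qPoch q q n * qPoch q q (2 * n + 2)) * q ^ ((n ^ 2 + 3 * n) / 2))
      (qPochInf (-q) q
        * (qPochInf (q ^ 3) (q ^ 18) * qPochInf (q ^ 15) (q ^ 18) * qPochInf (q ^ 18) (q ^ 18))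
        / qPochInf q q) := by
  rcases eq_or_ne q 0 with rfl | hq0
  · convert hasSum_single (α := ℂ) 0 fun n hn => ?_ using 1
    · simp [qPoch_zero, qPochInf_zero_left, qPoch_zero_left]
    · have : (n ^ 2 + 3 * n) / 2 ≠ 0 := by
        have : 0 < n := Nat.pos_of_ne_zero hn
        omega
      simp [this]
  have hp : ∀ m, m ≠ 0 → ‖q ^ m‖ < 1 := fun m hm => by
    simpa using pow_lt_one₀ (norm_nonneg q) hq hm
  have hb0 : -q⁻¹ ≠ 0 := neg_ne_zero.mpr (inv_ne_zero hq0)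
  -- With b = -1/q both q/b and bq^3 equal -q^2, so the b-factorials cancel in the row series.
  have hqb : q / -q⁻¹ = -q ^ 2 := by field_simp
  have hbq : -q⁻¹ * q ^ 3 = -q ^ 2 := by field_simp
  have hb : ‖-q ^ 2‖ < 1 := by rw [norm_neg]; exact hp 2 two_ne_zero
  have hj := hasSum_triple_product (q := q ^ 18) (x := q ^ 15) (y := q ^ 3) (pow_ne_zero _ hq0)
    (hp _ (by norm_num)) (by ring) (hp _ (by norm_num)) (hp _ (by norm_num))
  have hs := hasSum_slater (a := 0) (b := -q⁻¹) hq0 hq (by simp) (by rw [hbq]; exact hb) (by simp)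
    (hj.congr_fun fun r => by
      have s := neg_one_pow_mul_inv_pow hq0 (3 * r)
      rw [homPoch_eq hb0, hqb, hbq]
      have n1 := qPoch_ne_zero hq hb (3 * r)
      simp only [homPoch_zero_left, zero_mul, qPoch_zero_left, choose_two_three_mul,
        choose_two_succ]
      rw [one_mul, div_eq_iff n1]
      linear_combination ((-1) ^ r * q ^ (9 * r.choose 2 + 6 * r) * (1 - q ^ (6 * r + 3)) *
        q ^ (9 * r.choose 2 + 6 * r) * q ^ (3 * r) * qPoch (-q ^ 2) q (3 * r)) * s)
  -- The factor 1 + q completes (-q^2;q)_n to (-q;q)_{n+1}.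
  have hs2 := hs.mul_left (1 + q)
  have hv : (1 + q) * (qPochInf (0 * q ^ 3) q * qPochInf (-q⁻¹ * q ^ 3) q / (qPochInf q q *
        qPochInf (0 * -q⁻¹ * q ^ 2) q) *
        (qPochInf (q ^ 15) (q ^ 18) * qPochInf (q ^ 3) (q ^ 18) * qPochInf (q ^ 18) (q ^ 18)))
      = qPochInf (-q) q
        * (qPochInf (q ^ 3) (q ^ 18) * qPochInf (q ^ 15) (q ^ 18) * qPochInf (q ^ 18) (q ^ 18))
        / qPochInf q q := by
    rw [hbq, qPochInf_eq_qPoch_mul (-q) hq 1, pow_one, show -q * q = -q ^ 2 by ring]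
    simp only [zero_mul, qPochInf_zero_left, qPoch_succ, qPoch_zero]
    ring
  rw [hv] at hs2
  refine hs2.congr_fun fun n => ?_
  have s := neg_one_pow_mul_inv_pow hq0 n
  have e : (n ^ 2 + 3 * n) / 2 = n.choose 2 + 2 * n := by
    rw [sq_eq_two_mul_choose]
    omega
  rw [homPoch_eq hb0, hqb, e, qPoch_succ', show -q * q = -q ^ 2 by ring]
  simp only [homPoch_zero_left, choose_two_succ]
  linear_combination (-(1 + q) * q ^ (n.choose 2) * q ^ (2 * n) * qPoch (-q ^ 2) q n
    * qPoch (q ^ 3) (q ^ 3) n / (qPoch q q n * qPoch q q (2 * n + 2))) * s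

theorem slater116 {q : ℂ} (hq : ‖q‖ < 1) :
    HasSum (fun n : ℕ =>
        qPoch (-q) (q ^ 2) (n + 1) * qPoch (q ^ 6) (q ^ 6) n
          / (qPoch (q ^ 2) (q ^ 2) (2 * n + 2) * qPoch (q ^ 2) (q ^ 2) n) * q ^ (n ^ 2 + 4 * n))
      (qPochInf (-q) (q ^ 2)
        * (qPochInf (q ^ 3) (q ^ 36) * qPochInf (q ^ 33) (q ^ 36) * qPochInf (q ^ 36) (q ^ 36))
        / qPochInf (q ^ 2) (q ^ 2)) := by
  rcases eq_or_ne q 0 with rfl | hq0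
  · convert hasSum_single (α := ℂ) 0 fun n hn => ?_ using 1
    · simp [qPoch_zero, qPochInf_zero_left, qPoch_zero_left]
    · simp [hn]
  have hp : ∀ m, m ≠ 0 → ‖q ^ m‖ < 1 := fun m hm => by
    simpa using pow_lt_one₀ (norm_nonneg q) hq hm
  have hq2 := hp 2 two_ne_zero
  have hb0 : -q⁻¹ ≠ 0 := neg_ne_zero.mpr (inv_ne_zero hq0)
  have hqb : q ^ 2 / -q⁻¹ = -q ^ 3 := by field_simp
  have hbq : -q⁻¹ * (q ^ 2) ^ 3 = -q ^ 5 := by field_simp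
  have hb : ‖-q ^ 5‖ < 1 := by rw [norm_neg]; exact hp 5 (by norm_num)
  have n3 : ∀ m, m ≠ 0 → 1 + q ^ m ≠ 0 := fun m hm => by
    have := one_sub_ne_zero_of_norm_lt_one (a := -q ^ m) (by rw [norm_neg]; exact hp m hm)
    rwa [sub_neg_eq_add] at this
  have hj := (hasSum_triple_product (q := q ^ 36) (x := q ^ 33) (y := q ^ 3) (pow_ne_zero _ hq0)
    (hp _ (by norm_num)) (by ring) (hp _ (by norm_num)) (hp _ (by norm_num))).mul_left (1 + q ^ 3)
  have hs := hasSum_slater (a := 0) (b := -q⁻¹) (pow_ne_zero 2 hq0) hq2 (by simp)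
    (by rw [hbq]; exact hb) (by simp)
    (hj.congr_fun fun r => by
      have s := neg_one_pow_mul_inv_pow hq0 (3 * r)
      rw [homPoch_eq hb0, hqb, hbq]
      have n1 := qPoch_ne_zero hq2 hb (3 * r)
      -- In base q^2 the b-factorials differ by a shift. Splitting 1 - q^(12r+6) = (1 - q^(6r+3))(1
      -- + q^(6r+3)) supplies the missing factor and leaves the constant 1 + q^3 placed in `hj`.
      have ht : qPoch (-q ^ 3) (q ^ 2) (3 * r) * (1 + q ^ (6 * r + 3))
          = (1 + q ^ 3) * qPoch (-q ^ 5) (q ^ 2) (3 * r) := by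
        have := (qPoch_succ (-q ^ 3) (q ^ 2) (3 * r)).symm.trans (qPoch_succ' _ _ _)
        rw [show -q ^ 3 * q ^ 2 = -q ^ 5 by ring] at this
        linear_combination this
      simp only [homPoch_zero_left, zero_mul, qPoch_zero_left, choose_two_three_mul,
        choose_two_succ]
      rw [one_mul, div_eq_iff n1]
      linear_combination ((-1) ^ r * q ^ (36 * r.choose 2 + 33 * r) * (1 - q ^ (6 * r + 3)))
        * ht + ((-1) ^ r * q ^ (36 * r.choose 2 + 33 * r) * (1 - q ^ (12 * r + 6)) *
          qPoch (-q ^ 3) (q ^ 2) (3 * r)) * s)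
  have hs2 := hs.mul_left (1 + q)
  have hv : (1 + q) * (qPochInf (0 * (q ^ 2) ^ 3) (q ^ 2) * qPochInf (-q⁻¹ * (q ^ 2) ^ 3) (q ^ 2)
        / (qPochInf (q ^ 2) (q ^ 2) * qPochInf (0 * -q⁻¹ * (q ^ 2) ^ 2) (q ^ 2)) *
        ((1 + q ^ 3) *
        (qPochInf (q ^ 33) (q ^ 36) * qPochInf (q ^ 3) (q ^ 36) * qPochInf (q ^ 36) (q ^ 36))))
      = qPochInf (-q) (q ^ 2)
        * (qPochInf (q ^ 3) (q ^ 36) * qPochInf (q ^ 33) (q ^ 36) * qPochInf (q ^ 36) (q ^ 36))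
        / qPochInf (q ^ 2) (q ^ 2) := by
    rw [hbq, qPochInf_eq_qPoch_mul (-q) hq2 2, show -q * (q ^ 2) ^ 2 = -q ^ 5 by ring]
    simp only [zero_mul, qPochInf_zero_left, qPoch_succ, qPoch_zero]
    ring
  rw [hv] at hs2
  refine hs2.congr_fun fun n => ?_
  have s := neg_one_pow_mul_inv_pow hq0 n
  rw [homPoch_eq hb0, hqb, sq_eq_two_mul_choose n, qPoch_succ', show -q * q ^ 2 = -q ^ 3 by ring,
    show (q ^ 2) ^ 3 = q ^ 6 by ring]
  simp only [homPoch_zero_left, choose_two_succ]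
  linear_combination (-(1 + q) * q ^ (2 * n.choose 2) * q ^ (5 * n) * qPoch (-q ^ 3) (q ^ 2) n
    * qPoch (q ^ 6) (q ^ 6) n
    / (qPoch (q ^ 2) (q ^ 2) n * qPoch (q ^ 2) (q ^ 2) (2 * n + 2))) * s

theorem theoremT1 (q : ℂ) (hq : ‖q‖ < 1) :
    -- the two-parameter transformation, with convergence of both series
    (∀ a b : ℂ, a ≠ 0 → b ≠ 0 →
      ‖a * q ^ 3‖ < 1 → ‖b * q ^ 3‖ < 1 → ‖a * b * q ^ 2‖ < 1 →
      Summable (fun n : ℕ =>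
        qPoch (q / a) q n * qPoch (q / b) q n * qPoch (q ^ 3) (q ^ 3) n
          / (qPoch q q n * qPoch (q ^ 3) q (2 * n)) * (a * b) ^ n * q ^ (2 * n)) ∧
      Summable (fun n : ℕ =>
        (-1 : ℂ) ^ n * (1 - q ^ (6 * n + 3))
          * (qPoch (q / a) q (3 * n) * qPoch (q / b) q (3 * n)
            / (qPoch (a * q ^ 3) q (3 * n) * qPoch (b * q ^ 3) q (3 * n)))
          * (a * b) ^ (3 * n) * q ^ ((9 * n ^ 2 + 15 * n) / 2)) ∧
      qPochInf (q ^ 3) q * qPochInf (a * b * q ^ 2) q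
          / (qPochInf (a * q ^ 3) q * qPochInf (b * q ^ 3) q)
          * ∑' n : ℕ,
            qPoch (q / a) q n * qPoch (q / b) q n * qPoch (q ^ 3) (q ^ 3) n
              / (qPoch q q n * qPoch (q ^ 3) q (2 * n)) * (a * b) ^ n * q ^ (2 * n)
        = ∑' n : ℕ,
            (-1 : ℂ) ^ n * (1 - q ^ (6 * n + 3))
              * (qPoch (q / a) q (3 * n) * qPoch (q / b) q (3 * n)
                / (qPoch (a * q ^ 3) q (3 * n) * qPoch (b * q ^ 3) q (3 * n)))
              * (a * b) ^ (3 * n) * q ^ ((9 * n ^ 2 + 15 * n) / 2)) ∧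
    -- (S.76)
    HasSum (fun n : ℕ =>
        qPoch (-q) q (n + 1) * qPoch (q ^ 3) (q ^ 3) n
          / (qPoch q q n * qPoch q q (2 * n + 2)) * q ^ ((n ^ 2 + 3 * n) / 2))
      (qPochInf (-q) q
        * (qPochInf (q ^ 3) (q ^ 18) * qPochInf (q ^ 15) (q ^ 18) * qPochInf (q ^ 18) (q ^ 18))
        / qPochInf q q) ∧
    -- (S.90)
    HasSum (fun n : ℕ =>
        qPoch (q ^ 3) (q ^ 3) n
          / (qPoch q q n * qPoch q q (2 * n + 2)) * q ^ (n ^ 2 + 3 * n))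
      (qPochInf (q ^ 3) (q ^ 27) * qPochInf (q ^ 24) (q ^ 27) * qPochInf (q ^ 27) (q ^ 27)
        / qPochInf q q) ∧
    -- (S.116)
    HasSum (fun n : ℕ =>
        qPoch (-q) (q ^ 2) (n + 1) * qPoch (q ^ 6) (q ^ 6) n
          / (qPoch (q ^ 2) (q ^ 2) (2 * n + 2) * qPoch (q ^ 2) (q ^ 2) n) * q ^ (n ^ 2 + 4 * n))
      (qPochInf (-q) (q ^ 2)
        * (qPochInf (q ^ 3) (q ^ 36) * qPochInf (q ^ 33) (q ^ 36) * qPochInf (q ^ 36) (q ^ 36))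
        / qPochInf (q ^ 2) (q ^ 2)) := by
  refine ⟨fun a b ha0 hb0 ha hb h => ?_, slater76 hq, slater90 hq, slater116 hq⟩
  obtain ⟨S, h1, h2⟩ := cubic_transformation hq ha0 hb0 ha hb h
  refine ⟨h2.summable, h1.summable, ?_⟩
  rw [h2.tsum_eq, h1.tsum_eq]
  have hq3 : ‖q ^ 3‖ < 1 := by simpa using pow_lt_one₀ (norm_nonneg q) hq three_ne_zero
  have n1 := qPochInf_ne_zero hq ha
  have n2 := qPochInf_ne_zero hq hb
  have n3 := qPochInf_ne_zero hq hq3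
  have n4 := qPochInf_ne_zero hq h
  rw [← mul_assoc, div_mul_div_cancel₀ (mul_ne_zero n1 n2), div_self (mul_ne_zero n3 n4), one_mul]
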